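/- Let $d\ge 0$ be an integer and $\mathbb T^d=\mathbb R^d/\mathbb Z^d$. Let $\mathcal S(\mathbb T^d)$ be the space of all $u\in C^\infty(\mathbb T^d;\mathbb C)$ with $p_N(u):=\sup_{k\in\mathbb Z^d}(1+|k|^2)^N|\hat u(k)|<\infty$ for all $N\in\mathbb N$, where $\hat u(k)=\int_{\mathbb T^d}u(x)e^{-2\pi i k\cdot x}\,dx$, with the topology given by the seminorms $p_N$; define $\mathcal S(\mathbb T^d\times\mathbb T^d)$ in the same way on $\mathbb T^d\times\mathbb T^d=\mathbb T^{2d}$. Let $\mathcal S'$ denote the space of continuous linear functionals on $\mathcal S$, with the strong dual topology (uniform convergence on bounded sets). For $\psi,\varphi\in\mathcal S(\mathbb T^d)$ write $(\psi\otimes\varphi)(x,y)=\psi(x)\varphi(y)$. Let $\mathscr J$ be the space of continuous linear maps $L:\mathcal S(\mathbb T^d)\to\mathcal S'(\mathbb T^d)$ with the compact-open topology (uniform convergence on compact subsets of $\mathcal S(\mathbb T^d)$). Say that $S\in\mathcal S'(\mathbb T^d\times\mathbb T^d)$ is a kernel representing $L\in\mathscr J$ if $$\langle L\varphi,\psi\rangle=\langle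 S,\psi\otimes\varphi\rangle\qquad\text{for all }\varphi,\psi\in\mathcal S(\mathbb T^d).$$ **Theorem (Kernel Representation on Tori).** Every $L\in\mathscr J$ is represented by exactly one kernel $S\in\mathcal S'(\mathbb T^d\times\mathbb T^d)$. Moreover, every $S\in\mathcal S'(\mathbb T^d\times\mathbb T^d)$ represents exactly one $L\in\mathscr J$, and the map $t:\mathcal S'(\mathbb T^d\times\mathbb T^d)\to\mathscr J$ which sends $S$ to the $L$ that it represents is a linear homeomorphism (topological isomorphism) onto $\mathscr J$. -/

import Mathlib

open MeasureTheory Set Topology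
open scoped ContDiff

noncomputable section

namespace TorusKernel

variable (ι κ : Type) [Fintype ι] [Fintype κ]

/-- The weight `1 + |k|²` on `ℤ^ι`, with `|k|` the Euclidean length. -/
def weight {ι : Type} [Fintype ι] (k : ι → ℤ) : ℝ := 1 + ∑ i, (k i : ℝ) ^ 2

/-- The covering map `ℝ^ι → 𝕋^ι = (ℝ/ℤ)^ι`. -/
def proj {ι : Type} (x : ι → ℝ) : UnitAddTorus ι := fun i => (x i : UnitAddCircle)

lemma mFourierCoeff_add' {ι : Type} [Fintype ι] (u v : C(UnitAddTorus ι, ℂ)) (k : ι → ℤ) :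
    UnitAddTorus.mFourierCoeff (u + v : C(UnitAddTorus ι, ℂ)) k =
      UnitAddTorus.mFourierCoeff u k + UnitAddTorus.mFourierCoeff v k := by
  let _ : MeasureSpace UnitAddCircle := ⟨AddCircle.haarAddCircle⟩
  have _ : IsProbabilityMeasure (volume : Measure UnitAddCircle) :=
    inferInstanceAs (IsProbabilityMeasure AddCircle.haarAddCircle)
  simp only [UnitAddTorus.mFourierCoeff, ContinuousMap.add_apply, smul_add]
  apply integral_add <;>
  · apply Continuous.integrable_of_hasCompactSupport
    · fun_prop
    · exact HasCompactSupport.of_compactSpace _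

lemma mFourierCoeff_smul' {ι : Type} [Fintype ι] (c : ℂ) (u : C(UnitAddTorus ι, ℂ)) (k : ι → ℤ) :
    UnitAddTorus.mFourierCoeff (c • u : C(UnitAddTorus ι, ℂ)) k =
      c * UnitAddTorus.mFourierCoeff u k := by
  simp only [UnitAddTorus.mFourierCoeff, ContinuousMap.smul_apply, smul_eq_mul]
  rw [← integral_const_mul]
  congr 1
  ext t
  ring

lemma weight_pos {ι : Type} [Fintype ι] (k : ι → ℤ) : 0 < weight k := by
  unfold weight
  positivity

/-- The complex-valued functions on the torus `𝕋^ι` which are `C^∞` (that is, their `ℤ^ι`-periodic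
lift to `ℝ^ι` is `C^∞`) and satisfy `sup_k (1 + |k|²)^N |û(k)| < ∞` for all `N`. -/
def testSubmodule : Submodule ℂ C(UnitAddTorus ι, ℂ) where
  carrier := {u | ContDiff ℝ ∞ (fun x : ι → ℝ => u (proj x)) ∧
    ∀ N : ℕ, BddAbove (range fun k : ι → ℤ => weight k ^ N * ‖UnitAddTorus.mFourierCoeff u k‖)}
  add_mem' := by
    rintro u v ⟨hu, hu'⟩ ⟨hv, hv'⟩
    refine ⟨hu.add hv, fun N => ?_⟩
    obtain ⟨A, hA⟩ := hu' N
    obtain ⟨B, hB⟩ := hv' N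
    refine ⟨A + B, ?_⟩
    rintro _ ⟨k, rfl⟩
    have h1 := hA ⟨k, rfl⟩
    have h2 := hB ⟨k, rfl⟩
    have hw := pow_pos (weight_pos k) N
    simp only [mFourierCoeff_add'] at h1 h2 ⊢
    have := norm_add_le (UnitAddTorus.mFourierCoeff u k) (UnitAddTorus.mFourierCoeff v k)
    nlinarith [mul_le_mul_of_nonneg_left this hw.le]
  zero_mem' := by
    refine ⟨contDiff_const, fun N => ⟨0, ?_⟩⟩
    rintro _ ⟨k, rfl⟩
    simp [UnitAddTorus.mFourierCoeff]
  smul_mem' := by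
    rintro c u ⟨hu, hu'⟩
    refine ⟨contDiff_const.smul hu, fun N => ?_⟩
    obtain ⟨A, hA⟩ := hu' N
    refine ⟨‖c‖ * A, ?_⟩
    rintro _ ⟨k, rfl⟩
    have h1 := hA ⟨k, rfl⟩
    simp only [mFourierCoeff_smul', norm_mul] at h1 ⊢
    calc weight k ^ N * (‖c‖ * ‖UnitAddTorus.mFourierCoeff u k‖)
        = ‖c‖ * (weight k ^ N * ‖UnitAddTorus.mFourierCoeff u k‖) := by ring
      _ ≤ ‖c‖ * A := mul_le_mul_of_nonneg_left h1 (norm_nonneg c)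

/-- The test function space `𝓢(𝕋^ι)`. It is a separate type, because its topology (below) is not
the one of uniform convergence that it has as a space of continuous functions. -/
def Test : Type := ↥(testSubmodule ι)

instance : AddCommGroup (Test ι) := inferInstanceAs (AddCommGroup ↥(testSubmodule ι))

instance : Module ℂ (Test ι) := inferInstanceAs (Module ℂ ↥(testSubmodule ι))

variable {ι κ}

/-- The continuous function on the torus underlying a test function. -/
def Test.toCont (u : Test ι) : C(UnitAddTorus ι, ℂ) := Subtype.val u

instance : CoeFun (Test ι) (fun _ => UnitAddTorus ι → ℂ) := ⟨fun u => u.toCont⟩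

/-- The `k`-th Fourier coefficient `û(k) = ∫ u(x) e^{-2πi k·x} dx` of a test function. -/
def Test.coeff (u : Test ι) (k : ι → ℤ) : ℂ := UnitAddTorus.mFourierCoeff u.toCont k

lemma Test.bddAbove (u : Test ι) (N : ℕ) :
    BddAbove (range fun k : ι → ℤ => weight k ^ N * ‖u.coeff k‖) := u.2.2 N

lemma Test.coeff_add (u v : Test ι) (k : ι → ℤ) : (u + v).coeff k = u.coeff k + v.coeff k :=
  mFourierCoeff_add' _ _ k

lemma Test.coeff_smul (c : ℂ) (u : Test ι) (k : ι → ℤ) : (c • u).coeff k = c * u.coeff k :=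
  mFourierCoeff_smul' _ _ k

variable (ι) in
/-- The seminorms `p_N(u) = sup_k (1 + |k|²)^N |û(k)|` on `𝓢(𝕋^ι)`. -/
def testSeminorm : SeminormFamily ℂ (Test ι) ℕ := fun N =>
  Seminorm.of (fun u => ⨆ k : ι → ℤ, weight k ^ N * ‖u.coeff k‖)
    (by
      intro u v
      refine ciSup_le fun k => ?_
      have h1 := le_ciSup (u.bddAbove N) k
      have h2 := le_ciSup (v.bddAbove N) k
      have hw := pow_pos (weight_pos k) N
      rw [Test.coeff_add]
      have := mul_le_mul_of_nonneg_left (norm_add_le (u.coeff k) (v.coeff k)) hw.le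
      linarith)
    (by
      intro c u
      rw [Real.mul_iSup_of_nonneg (norm_nonneg c)]
      congr 1
      ext k
      rw [Test.coeff_smul, norm_mul]
      ring)

lemma testSeminorm_apply (N : ℕ) (u : Test ι) :
    testSeminorm ι N u = ⨆ k : ι → ℤ, weight k ^ N * ‖u.coeff k‖ := rfl

/-- The (Fréchet) topology of `𝓢(𝕋^ι)`, generated by the seminorms `p_N`. -/
instance : TopologicalSpace (Test ι) := (testSeminorm ι).moduleFilterBasis.topology

lemma test_withSeminorms : WithSeminorms (testSeminorm ι) := ⟨rfl⟩

instance : IsTopologicalAddGroup (Test ι) := test_withSeminorms.topologicalAddGroup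

instance : ContinuousSMul ℂ (Test ι) := test_withSeminorms.continuousSMul

variable (ι) in
/-- The space `𝓢'(𝕋^ι)` of distributions on the torus: the continuous linear functionals on
`𝓢(𝕋^ι)`, with the usual topology of the dual (Mathlib's topology on `→L`: uniform convergence on
the bounded subsets of `𝓢(𝕋^ι)`). -/
abbrev Distribution : Type := Test ι →L[ℂ] ℂ

variable (ι κ) in
/-- The space of continuous linear maps `𝓢(𝕋^ι) → 𝓢'(𝕋^κ)`, with the compact-open topology
(uniform convergence on the compact subsets of `𝓢(𝕋^ι)`). -/
abbrev Operator : Type := CompactConvergenceCLM (RingHom.id ℂ) (Test ι) (Distribution κ)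

lemma mFourierCoeff_tensor (f : C(UnitAddTorus ι, ℂ)) (g : C(UnitAddTorus κ, ℂ)) (k : ι ⊕ κ → ℤ) :
    UnitAddTorus.mFourierCoeff (fun z : UnitAddTorus (ι ⊕ κ) => f (z ∘ Sum.inl) * g (z ∘ Sum.inr)) k
      = UnitAddTorus.mFourierCoeff f (k ∘ Sum.inl) * UnitAddTorus.mFourierCoeff g (k ∘ Sum.inr) := by
  let _ : MeasureSpace UnitAddCircle := ⟨AddCircle.haarAddCircle⟩
  have _ : IsProbabilityMeasure (volume : Measure UnitAddCircle) :=
    inferInstanceAs (IsProbabilityMeasure AddCircle.haarAddCircle)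
  have h := (volume_measurePreserving_sumPiEquivProdPi
    (fun _ : ι ⊕ κ => UnitAddCircle)).integral_comp'
    (fun p : UnitAddTorus ι × UnitAddTorus κ =>
      (UnitAddTorus.mFourier (-(k ∘ Sum.inl)) p.1 • f p.1) *
        (UnitAddTorus.mFourier (-(k ∘ Sum.inr)) p.2 • g p.2))
  unfold UnitAddTorus.mFourierCoeff
  rw [← integral_prod_mul]
  refine Eq.trans ?_ h
  congr 1
  ext z
  simp only [UnitAddTorus.mFourier, ContinuousMap.coe_mk, Fintype.prod_sum_type, smul_eq_mul,
    Pi.neg_apply, MeasurableEquiv.coe_sumPiEquivProdPi, Equiv.sumPiEquivProdPi, Equiv.coe_fn_mk,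
    Function.comp_apply]
  simp only [Function.comp_def]
  ring

lemma weight_le (k : ι ⊕ κ → ℤ) : weight k ≤ weight (k ∘ Sum.inl) * weight (k ∘ Sum.inr) := by
  simp only [weight, Fintype.sum_sum_type, Function.comp_apply]
  have h1 : 0 ≤ ∑ i : ι, (k (Sum.inl i) : ℝ) ^ 2 := by positivity
  have h2 : 0 ≤ ∑ i : κ, (k (Sum.inr i) : ℝ) ^ 2 := by positivity
  nlinarith [mul_nonneg h1 h2]

/-- The tensor product `(f ⊗ g)(x, y) = f(x) g(y)` of test functions. The product torus
`𝕋^ι × 𝕋^κ` is `𝕋^(ι ⊕ κ)`, whose points `z` are the pairs `x = z ∘ inl`, `y = z ∘ inr`. -/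
def tensor (f : Test ι) (g : Test κ) : Test (ι ⊕ κ) :=
  ⟨⟨fun z => f (z ∘ Sum.inl) * g (z ∘ Sum.inr), by
      have h1 := f.toCont.continuous
      have h2 := g.toCont.continuous
      fun_prop⟩, by
    refine ⟨?_, fun N => ?_⟩
    · have hf : ContDiff ℝ ∞ (fun x : ι ⊕ κ → ℝ => f (proj (fun i => x (Sum.inl i)))) :=
        f.2.1.comp (by fun_prop)
      have hg : ContDiff ℝ ∞ (fun x : ι ⊕ κ → ℝ => g (proj (fun i => x (Sum.inr i)))) :=
        g.2.1.comp (by fun_prop)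
      exact hf.mul hg
    · obtain ⟨A, hA⟩ := f.bddAbove N
      obtain ⟨B, hB⟩ := g.bddAbove N
      refine ⟨A * B, ?_⟩
      rintro _ ⟨k, rfl⟩
      have h1 := hA ⟨k ∘ Sum.inl, rfl⟩
      have h2 := hB ⟨k ∘ Sum.inr, rfl⟩
      have hw1 := pow_pos (weight_pos (k ∘ Sum.inl)) N
      have hw2 := pow_pos (weight_pos (k ∘ Sum.inr)) N
      simp only [ContinuousMap.coe_mk, mFourierCoeff_tensor, norm_mul]
      simp only [Test.coeff] at h1 h2
      calc _ ≤ (weight (k ∘ Sum.inl) * weight (k ∘ Sum.inr)) ^ N * _ := by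
            gcongr
            · exact (weight_pos k).le
            · exact weight_le k
        _ = (weight (k ∘ Sum.inl) ^ N * ‖UnitAddTorus.mFourierCoeff f (k ∘ Sum.inl)‖) *
            (weight (k ∘ Sum.inr) ^ N * ‖UnitAddTorus.mFourierCoeff g (k ∘ Sum.inr)‖) := by
          ring
        _ ≤ A * B := by
          refine mul_le_mul h1 h2 (by positivity) (le_trans (by positivity) h1)⟩

lemma tensor_apply (f : Test ι) (g : Test κ) (z : UnitAddTorus (ι ⊕ κ)) :
    tensor f g z = f (z ∘ Sum.inl) * g (z ∘ Sum.inr) := rfl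

/-- `S ∈ 𝓢'(𝕋^κ × 𝕋^ι)` is a kernel representing `L : 𝓢(𝕋^ι) → 𝓢'(𝕋^κ)`, formally
`(L φ)(x) = ∫ S(x, y) φ(y) dy`, if `⟨L φ, ψ⟩ = ⟨S, ψ ⊗ φ⟩` for all test functions `φ`, `ψ`. -/
def Represents (S : Distribution (κ ⊕ ι)) (L : Operator ι κ) : Prop :=
  ∀ (φ : Test ι) (ψ : Test κ), L φ ψ = S (tensor ψ φ)

end TorusKernel

end

namespace TorusKernel

variable {ι κ : Type} [Fintype ι] [Fintype κ]

/-! In Fourier coordinates everything becomes a statement about sequences. A test function is the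
sum of its Fourier series in the topology of the `p_N` (`hasSum_expo`), so a distribution is
determined by its values on exponentials, and any values of polynomial growth occur
(`exists_distribution`). Since a tensor product of exponentials is an exponential, a kernel `S` and
its operator `L` carry the same data: the matrix `L (expo l) (expo m)`.

Injectivity is then immediate. Surjectivity amounts to polynomial growth of this matrix
(`Operator.exists_norm_apply_expo_le`), obtained from continuity of `L` into the strong dual by
testing on one well-chosen bounded set.

The map `t` is continuous because tensor products of two bounded sets form a bounded set. Its
inverse is continuous because a bounded set on the product torus is controlled by tensors of
suitably scaled exponentials, and these scaled exponentials form compact sets in each factor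
(`exists_isCompact_norm_le`). -/

/-! ### Weights, exponentials and seminorm estimates -/

lemma one_le_weight (k : ι → ℤ) : 1 ≤ weight k := by
  unfold weight
  have : 0 ≤ ∑ i, (k i : ℝ) ^ 2 := by positivity
  linarith

/-- Each factor `1 + (k i)²` is at most `weight k`, so the term is dominated by a product of
one-variable terms, and the sum of those over a box factorises. -/
lemma summable_inv_weight_pow_card :
    Summable fun k : ι → ℤ => (weight k ^ Fintype.card ι)⁻¹ := by
  classical
  have hs : Summable fun n : ℤ => (1 + (n : ℝ) ^ 2)⁻¹ := by
    have h2 : Summable fun n : ℤ => 1 / (n : ℝ) ^ 2 := Real.summable_one_div_int_pow.2 one_lt_two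
    -- The indicator of `0` pays for the term `n = 0`, where `1 / n ^ 2` takes the value `0`.
    refine (h2.add (summable_of_ne_finset_zero (s := {0})
      (f := fun n : ℤ => if n = 0 then (1 : ℝ) else 0) (by simp +contextual))).of_nonneg_of_le
      (fun n => by positivity) fun n => ?_
    rcases eq_or_ne n 0 with rfl | hn
    · simp
    · have : (0 : ℝ) < (n : ℝ) ^ 2 := by positivity
      simp only [hn, if_false, add_zero, one_div]
      exact inv_anti₀ this (by linarith)
  have hle : ∀ k : ι → ℤ, (weight k ^ Fintype.card ι)⁻¹ ≤ ∏ i, (1 + (k i : ℝ) ^ 2)⁻¹ := by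
    intro k
    rw [Finset.prod_inv_distrib]
    refine inv_anti₀ (Finset.prod_pos fun i _ => by positivity) ?_
    rw [← Finset.card_univ, ← Finset.prod_const]
    refine Finset.prod_le_prod (fun i _ => by positivity) fun i _ => ?_
    unfold weight
    have := Finset.single_le_sum (f := fun i => (k i : ℝ) ^ 2) (fun i _ => sq_nonneg _)
      (Finset.mem_univ i)
    simpa using this
  refine Summable.of_nonneg_of_le (fun k => by have := weight_pos k; positivity) hle ?_
  refine summable_of_sum_le (c := ∏ _i : ι, ∑' n : ℤ, (1 + (n : ℝ) ^ 2)⁻¹)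
    (fun k => Finset.prod_nonneg fun i _ => by positivity) fun s => ?_
  calc ∑ k ∈ s, ∏ i, (1 + (k i : ℝ) ^ 2)⁻¹
      ≤ ∑ k ∈ Fintype.piFinset fun i => s.image fun k => k i, ∏ i, (1 + ((k i : ℤ) : ℝ) ^ 2)⁻¹ := by
        refine Finset.sum_le_sum_of_subset_of_nonneg (fun k hk => ?_)
          fun k _ _ => Finset.prod_nonneg fun i _ => by positivity
        rw [Fintype.mem_piFinset]
        exact fun i => Finset.mem_image_of_mem (fun k : ι → ℤ => k i) hk
    _ = ∏ i, ∑ n ∈ s.image fun k => k i, (1 + ((n : ℤ) : ℝ) ^ 2)⁻¹ :=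
        (Finset.prod_univ_sum _ fun _ (n : ℤ) => (1 + (n : ℝ) ^ 2)⁻¹).symm
    _ ≤ _ := Finset.prod_le_prod (fun i _ => Finset.sum_nonneg fun n _ => by positivity)
        fun i _ => hs.sum_le_tsum _ fun n _ => by positivity

lemma mFourierCoeff_mFourier [DecidableEq (ι → ℤ)] (k j : ι → ℤ) :
    UnitAddTorus.mFourierCoeff (UnitAddTorus.mFourier k) j = if j = k then 1 else 0 := by
  let _ : MeasureSpace UnitAddCircle := ⟨AddCircle.haarAddCircle⟩
  have _ : IsProbabilityMeasure (volume : Measure UnitAddCircle) :=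
    inferInstanceAs (IsProbabilityMeasure AddCircle.haarAddCircle)
  have h := orthonormal_iff_ite.1 (UnitAddTorus.orthonormal_mFourier (d := ι)) j k
  rw [ContinuousMap.inner_toLp] at h
  rw [← h]
  simp only [UnitAddTorus.mFourierCoeff, UnitAddTorus.mFourier_neg, smul_eq_mul, mul_comm]

/-- The exponential `x ↦ e^{2πi k·x}` as a test function. -/
noncomputable def expo (k : ι → ℤ) : Test ι :=
  ⟨UnitAddTorus.mFourier k, by
    classical
    refine ⟨?_, fun N => ⟨weight k ^ N, ?_⟩⟩
    · simp only [UnitAddTorus.mFourier, ContinuousMap.coe_mk, proj, fourier_coe_apply]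
      refine contDiff_prod fun i _ => ?_
      have : ContDiff ℝ ∞ fun x : ι → ℝ => (x i : ℂ) :=
        Complex.ofRealCLM.contDiff.comp (contDiff_apply ℝ ℝ i)
      exact ((contDiff_const.mul this).div_const _).cexp
    · rintro _ ⟨j, rfl⟩
      simp only [mFourierCoeff_mFourier]
      split_ifs with h
      · simp [h]
      · simpa using pow_nonneg (weight_pos k).le N⟩

lemma expo_apply (k : ι → ℤ) (x : UnitAddTorus ι) : expo k x = UnitAddTorus.mFourier k x := rfl

lemma Test.ext {u v : Test ι} (h : ∀ x, u x = v x) : u = v :=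
  Subtype.ext (ContinuousMap.ext h)

lemma coeff_expo [DecidableEq (ι → ℤ)] (k j : ι → ℤ) :
    (expo k).coeff j = if j = k then 1 else 0 := mFourierCoeff_mFourier k j

lemma tensor_expo (m : ι → ℤ) (l : κ → ℤ) : tensor (expo m) (expo l) = expo (Sum.elim m l) := by
  apply Test.ext
  intro x
  simp [tensor_apply, expo_apply, UnitAddTorus.mFourier]

lemma coeff_tensor (f : Test ι) (g : Test κ) (k : ι ⊕ κ → ℤ) :
    (tensor f g).coeff k = f.coeff (k ∘ Sum.inl) * g.coeff (k ∘ Sum.inr) :=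
  mFourierCoeff_tensor f.toCont g.toCont k

lemma le_testSeminorm (N : ℕ) (u : Test ι) (k : ι → ℤ) :
    weight k ^ N * ‖u.coeff k‖ ≤ testSeminorm ι N u := le_ciSup (u.bddAbove N) k

lemma testSeminorm_le {N : ℕ} {u : Test ι} {C : ℝ}
    (h : ∀ k, weight k ^ N * ‖u.coeff k‖ ≤ C) : testSeminorm ι N u ≤ C := ciSup_le h

lemma testSeminorm_mono : Monotone (testSeminorm ι) := fun _ _ h u =>
  testSeminorm_le fun k => le_trans (by gcongr; exact one_le_weight k) (le_testSeminorm _ u k)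

lemma testSeminorm_smul_expo_le (N : ℕ) (c : ℂ) (k : ι → ℤ) :
    testSeminorm ι N (c • expo k) ≤ weight k ^ N * ‖c‖ := by
  classical
  refine testSeminorm_le fun j => ?_
  have := weight_pos k
  rw [Test.coeff_smul, coeff_expo]
  split_ifs with h
  · simp [h]
  · simp only [mul_zero, norm_zero]; positivity

lemma testSeminorm_tensor_le (N : ℕ) (f : Test ι) (g : Test κ) :
    testSeminorm (ι ⊕ κ) N (tensor f g) ≤ testSeminorm ι N f * testSeminorm κ N g := by
  refine testSeminorm_le fun k => ?_
  have hw1 := weight_pos (k ∘ Sum.inl)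
  have hw2 := weight_pos (k ∘ Sum.inr)
  rw [coeff_tensor, norm_mul]
  calc _ ≤ (weight (k ∘ Sum.inl) * weight (k ∘ Sum.inr)) ^ N * _ := by
        gcongr
        · exact (weight_pos k).le
        · exact weight_le k
    _ = (weight (k ∘ Sum.inl) ^ N * ‖f.coeff (k ∘ Sum.inl)‖) *
        (weight (k ∘ Sum.inr) ^ N * ‖g.coeff (k ∘ Sum.inr)‖) := by ring
    _ ≤ _ := mul_le_mul (le_testSeminorm N f _) (le_testSeminorm N g _) (by positivity)
        (apply_nonneg _ _)

/-- A continuous seminorm on `𝓢(𝕋^ι)` is dominated by one of the `p_N`. -/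
lemma exists_le_testSeminorm (q : Seminorm ℂ (Test ι)) (hq : Continuous q) :
    ∃ (N : ℕ) (C : ℝ), 0 ≤ C ∧ ∀ u, q u ≤ C * testSeminorm ι N u := by
  obtain ⟨s, C, -, h⟩ := Seminorm.bound_of_continuous test_withSeminorms q hq
  refine ⟨s.sup id, C, C.2, fun u => (h u).trans ?_⟩
  have : s.sup (testSeminorm ι) ≤ testSeminorm ι (s.sup id) :=
    Finset.sup_le fun i hi => testSeminorm_mono (Finset.le_sup (f := id) hi)
  exact mul_le_mul_of_nonneg_left (this u) C.2

lemma Distribution.bound (S : Distribution ι) :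
    ∃ (N : ℕ) (C : ℝ), 0 ≤ C ∧ ∀ u, ‖S u‖ ≤ C * testSeminorm ι N u :=
  exists_le_testSeminorm ((normSeminorm ℂ ℂ).comp S.toLinearMap) (by
    change Continuous fun u => ‖S u‖
    fun_prop)

lemma continuous_of_testSeminorm_bound (S : Test ι →ₗ[ℂ] ℂ) (N : ℕ) (C : ℝ) (hC : 0 ≤ C)
    (h : ∀ u, ‖S u‖ ≤ C * testSeminorm ι N u) : Continuous S := by
  refine test_withSeminorms.continuous_normedSpace_rng ℂ S ⟨{N}, ⟨C, hC⟩, fun u => ?_⟩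
  rw [Finset.sup_singleton]
  exact h u

/-! ### Fourier series of test functions and distributions -/

lemma summable_weight_pow_mul_norm_coeff (u : Test ι) (N : ℕ) :
    Summable fun k : ι → ℤ => weight k ^ N * ‖u.coeff k‖ := by
  refine ((summable_inv_weight_pow_card (ι := ι)).mul_left
    (testSeminorm ι (N + Fintype.card ι) u)).of_nonneg_of_le
    (fun k => by have := weight_pos k; positivity) fun k => ?_
  have := pow_pos (weight_pos k) (Fintype.card ι)
  rw [← div_eq_mul_inv, le_div_iff₀ this]
  refine le_trans (le_of_eq ?_) (le_testSeminorm _ u k)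
  ring

lemma Test.coeff_sum {α : Type*} (s : Finset α) (f : α → Test ι) (j : ι → ℤ) :
    (∑ a ∈ s, f a).coeff j = ∑ a ∈ s, (f a).coeff j :=
  map_sum (AddMonoidHom.mk' (fun u : Test ι => u.coeff j) fun u v => Test.coeff_add u v j) f s

/-- The remainder after summing over `s` has the coefficients of `-u` outside `s` and `0` inside, so
its `p_N` is a supremum over the complement of `s`. Only the seminorms matter: neither pointwise
convergence nor uniqueness of Fourier coefficients enters. -/
lemma hasSum_expo (u : Test ι) : HasSum (fun k => u.coeff k • expo k) u := by
  classical
  refine (test_withSeminorms.tendsto_nhds _ u).2 fun N ε hε => ?_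
  have h0 := (summable_weight_pow_mul_norm_coeff u N).tendsto_cofinite_zero
  have hfin := h0.eventually (gt_mem_nhds (half_pos hε))
  rw [Filter.eventually_cofinite] at hfin
  filter_upwards [Filter.eventually_ge_atTop hfin.toFinset] with s hs
  refine (testSeminorm_le (C := ε / 2) fun j => ?_).trans_lt (half_lt_self hε)
  have : (∑ k ∈ s, u.coeff k • expo k - u).coeff j = if j ∈ s then 0 else - u.coeff j := by
    have h1 : (∑ k ∈ s, u.coeff k • expo k - u) = ∑ k ∈ s, u.coeff k • expo k + (-1 : ℂ) • u := by
      simp [sub_eq_add_neg]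
    rw [h1, Test.coeff_add, Test.coeff_sum, Test.coeff_smul]
    simp only [Test.coeff_smul, coeff_expo, mul_ite, mul_one, mul_zero, Finset.sum_ite_eq]
    split_ifs <;> simp
  rw [this]
  split_ifs with hj
  · simpa using (half_pos hε).le
  · rw [norm_neg]
    by_contra! hlt
    exact hj (hs (by simpa using hlt.le))

lemma Distribution.hasSum (S : Distribution ι) (u : Test ι) :
    HasSum (fun k => u.coeff k * S (expo k)) (S u) := by
  simpa using (hasSum_expo u).mapL S

lemma Distribution.ext_expo {S T : Distribution ι} (h : ∀ k, S (expo k) = T (expo k)) : S = T := by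
  ext u
  refine (S.hasSum u).unique ?_
  simpa only [h] using T.hasSum u

/-- The distribution with prescribed Fourier coefficients of polynomial growth. -/
lemma exists_distribution (s : (ι → ℤ) → ℂ) (N : ℕ) (C : ℝ) (hs : ∀ k, ‖s k‖ ≤ C * weight k ^ N) :
    ∃ S : Distribution ι, ∀ k, S (expo k) = s k := by
  classical
  have hC : 0 ≤ C := nonneg_of_mul_nonneg_left ((norm_nonneg _).trans (hs 0))
    (pow_pos (weight_pos _) N)
  have hle : ∀ (u : Test ι) k, ‖u.coeff k * s k‖ ≤ C * (weight k ^ N * ‖u.coeff k‖) := by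
    intro u k
    rw [norm_mul]
    calc _ ≤ ‖u.coeff k‖ * (C * weight k ^ N) := by gcongr; exact hs k
      _ = _ := by ring
  have hsum : ∀ u : Test ι, Summable fun k => u.coeff k * s k := fun u =>
    .of_norm_bounded ((summable_weight_pow_mul_norm_coeff u N).mul_left C) (hle u)
  let T : Test ι →ₗ[ℂ] ℂ :=
    { toFun := fun u => ∑' k, u.coeff k * s k
      map_add' := fun u v => by
        rw [← (hsum u).tsum_add (hsum v)]
        simp only [Test.coeff_add, add_mul]
      map_smul' := fun c u => by
        simp only [Test.coeff_smul, mul_assoc, tsum_mul_left, RingHom.id_apply, smul_eq_mul] }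
  -- Raising the order by `Fintype.card ι` leaves a summable factor in each term.
  refine ⟨⟨T, continuous_of_testSeminorm_bound T (N + Fintype.card ι)
    (C * ∑' k : ι → ℤ, (weight k ^ Fintype.card ι)⁻¹) ?_ fun u => ?_⟩, fun k => ?_⟩
  · exact mul_nonneg hC (tsum_nonneg fun k => by have := weight_pos k; positivity)
  · refine (tsum_of_norm_bounded ((summable_inv_weight_pow_card.hasSum.mul_left
      (C * testSeminorm ι (N + Fintype.card ι) u))) fun k => (hle u k).trans ?_).trans
      (le_of_eq (by ring))
    have := pow_pos (weight_pos k) (Fintype.card ι)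
    rw [← div_eq_mul_inv, le_div_iff₀ this]
    calc _ = C * (weight k ^ (N + Fintype.card ι) * ‖u.coeff k‖) := by ring
      _ ≤ _ := by gcongr; exact le_testSeminorm _ u k
  · change ∑' j, (expo k).coeff j * s j = s k
    simp [coeff_expo]

/-! ### From kernels to operators -/

lemma tensor_add_left (f g : Test ι) (h : Test κ) :
    tensor (f + g) h = tensor f h + tensor g h := Test.ext fun _ => add_mul _ _ _

lemma tensor_add_right (f : Test ι) (g h : Test κ) :
    tensor f (g + h) = tensor f g + tensor f h := Test.ext fun _ => mul_add _ _ _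

lemma tensor_smul_left (c : ℂ) (f : Test ι) (g : Test κ) :
    tensor (c • f) g = c • tensor f g := Test.ext fun _ => mul_assoc _ _ _

lemma tensor_smul_right (c : ℂ) (f : Test ι) (g : Test κ) :
    tensor f (c • g) = c • tensor f g := Test.ext fun _ => mul_left_comm _ _ _

lemma Distribution.norm_tensor_bound (S : Distribution (κ ⊕ ι)) :
    ∃ (N : ℕ) (C : ℝ), 0 ≤ C ∧ ∀ (ψ : Test κ) (φ : Test ι),
      ‖S (tensor ψ φ)‖ ≤ C * testSeminorm κ N ψ * testSeminorm ι N φ := by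
  obtain ⟨N, C, hC, h⟩ := S.bound
  refine ⟨N, C, hC, fun ψ φ => (h _).trans ?_⟩
  rw [mul_assoc]
  exact mul_le_mul_of_nonneg_left (testSeminorm_tensor_le N ψ φ) hC

/-- The distribution `ψ ↦ ⟨S, ψ ⊗ φ⟩`. -/
noncomputable def Distribution.slice (S : Distribution (κ ⊕ ι)) (φ : Test ι) : Distribution κ where
  toFun ψ := S (tensor ψ φ)
  map_add' f g := by rw [tensor_add_left, map_add]
  map_smul' c f := by rw [tensor_smul_left, map_smul, RingHom.id_apply]
  cont := by
    obtain ⟨N, C, hC, h⟩ := S.norm_tensor_bound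
    exact continuous_of_testSeminorm_bound
      { toFun := fun ψ => S (tensor ψ φ)
        map_add' := fun f g => by rw [tensor_add_left, map_add]
        map_smul' := fun c f => by rw [tensor_smul_left, map_smul, RingHom.id_apply] }
      N (C * testSeminorm ι N φ) (mul_nonneg hC (apply_nonneg _ _))
      fun ψ => (h ψ φ).trans (le_of_eq (by ring))

lemma Distribution.slice_apply (S : Distribution (κ ⊕ ι)) (φ : Test ι) (ψ : Test κ) :
    S.slice φ ψ = S (tensor ψ φ) := rfl

/-- The sets `{f | |f| ≤ ε on B}`, with `B` bounded and `ε > 0`, are a neighbourhood basis of `0`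
in the strong dual. -/
lemma Distribution.hasBasis_nhds_zero :
    (𝓝 (0 : Distribution ι)).HasBasis
      (fun p : Set (Test ι) × ℝ => Bornology.IsVonNBounded ℂ p.1 ∧ 0 < p.2)
      fun p => {f | ∀ u ∈ p.1, ‖f u‖ ≤ p.2} := by
  simpa using ContinuousLinearMap.hasBasis_nhds_zero_of_basis (σ := RingHom.id ℂ) (E := Test ι)
    (Metric.nhds_basis_closedBall (x := (0 : ℂ)))

lemma exists_testSeminorm_le_of_isVonNBounded {B : Set (Test ι)}
    (hB : Bornology.IsVonNBounded ℂ B) (N : ℕ) :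
    ∃ R, 0 < R ∧ ∀ u ∈ B, testSeminorm ι N u ≤ R := by
  obtain ⟨R, hR, h⟩ := test_withSeminorms.isVonNBounded_iff_seminorm_bounded.1 hB N
  exact ⟨R, hR, fun u hu => (h u hu).le⟩

lemma Distribution.continuous_slice (S : Distribution (κ ⊕ ι)) :
    Continuous (AddMonoidHom.mk' S.slice fun f g => by
      ext ψ; simp [slice_apply, tensor_add_right]) := by
  refine continuous_of_tendsto_nhds_zero _
    (Distribution.hasBasis_nhds_zero.tendsto_right_iff.2 ?_)
  rintro ⟨B, ε⟩ ⟨hB, hε⟩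
  obtain ⟨N, C, hC, h⟩ := S.norm_tensor_bound
  obtain ⟨R, -, hR⟩ := exists_testSeminorm_le_of_isVonNBounded hB N
  -- On `B` the bound on `S (tensor ψ φ)` is uniform in `ψ`, and it tends to `0` with `φ`.
  have hcont : Continuous fun φ : Test ι => C * R * testSeminorm ι N φ :=
    continuous_const.mul (test_withSeminorms.continuous_seminorm N)
  filter_upwards [(hcont.tendsto' 0 0 (by simp)).eventually (gt_mem_nhds hε)]
    with φ hφ ψ hψ
  refine (h ψ φ).trans (le_trans ?_ hφ.le)
  have := apply_nonneg (testSeminorm ι N) φ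
  gcongr
  exact hR ψ hψ

/-- The operator represented by a kernel, as a continuous linear map. -/
noncomputable def Distribution.sliceCLM (S : Distribution (κ ⊕ ι)) :
    Test ι →L[ℂ] Distribution κ where
  toFun := S.slice
  map_add' f g := by ext ψ; simp [slice_apply, tensor_add_right]
  map_smul' c f := by ext ψ; simp [slice_apply, tensor_smul_right]
  cont := S.continuous_slice

/-- The linear map sending a kernel to the operator that it represents. -/
noncomputable def kernelToOperator : Distribution (κ ⊕ ι) →ₗ[ℂ] Operator ι κ :=
  (ContinuousLinearMap.toUniformConvergenceCLM (RingHom.id ℂ) (Distribution κ)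
    {s : Set (Test ι) | IsCompact s}).toLinearMap ∘ₗ
  { toFun := Distribution.sliceCLM
    map_add' := fun _ _ => rfl
    map_smul' := fun _ _ => rfl }

lemma kernelToOperator_apply (S : Distribution (κ ⊕ ι)) (φ : Test ι) (ψ : Test κ) :
    kernelToOperator S φ ψ = S (tensor ψ φ) := rfl

/-! ### The matrix of an operator, and bijectivity -/

/-- Separate continuity of `L φ ψ` suffices: the expansion is made in `ψ` at a fixed exponential,
then in `φ` at a fixed `ψ`. -/
lemma Operator.ext_expo {L M : Operator ι κ} (h : ∀ l m, L (expo l) (expo m) = M (expo l) (expo m)) :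
    L = M := by
  have hc : ∀ (L : Operator ι κ) (ψ : Test κ), Continuous fun φ => L φ ψ := fun L ψ =>
    (continuous_eval_const (F := Distribution κ) ψ).comp (map_continuous L)
  let ev (L : Operator ι κ) (ψ : Test κ) : Distribution ι :=
    ⟨{ toFun := fun φ => L φ ψ
       map_add' := fun f g => by rw [map_add]; rfl
       map_smul' := fun c f => by rw [map_smul]; rfl }, hc L ψ⟩
  have h1 : ∀ l, L (expo l) = M (expo l) := fun l => Distribution.ext_expo (h l)
  refine UniformConvergenceCLM.ext _ _ fun φ => ContinuousLinearMap.ext fun ψ => ?_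
  have : ev L ψ = ev M ψ := Distribution.ext_expo fun l => by
    change L (expo l) ψ = M (expo l) ψ
    rw [h1]
  exact DFunLike.congr_fun this φ

/-- The matrix of a continuous operator in the Fourier basis grows at most polynomially. -/
lemma Operator.exists_norm_apply_expo_le (L : Operator ι κ) :
    ∃ (N : ℕ) (C : ℝ), ∀ l m,
      ‖L (expo l) (expo m)‖ ≤ C * (weight l ^ N * weight m ^ N) := by
  by_contra! h
  -- Order and constant are both taken to be `N`, so that one sequence of frequencies defeats every
  -- polynomial bound.
  choose l m hlm using fun N : ℕ => h N N
  -- `B` is bounded: once `N ≥ M` the `N`-th element has `p_M` at most `1`, which leaves finitely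
  -- many elements for each `M`.
  let B : Set (Test κ) := range fun N => (((weight (m N) ^ N)⁻¹ : ℝ) : ℂ) • expo (m N)
  have hB : Bornology.IsVonNBounded ℂ B := by
    refine test_withSeminorms.isVonNBounded_iff_seminorm_bddAbove.2 fun M => ?_
    refine (Filter.isBoundedUnder_of_eventually_le (f := Filter.atTop) (a := 1)
      (u := fun N => testSeminorm κ M ((((weight (m N) ^ N)⁻¹ : ℝ) : ℂ) • expo (m N)))
      ?_).bddAbove_range.mono (by rintro _ ⟨_, ⟨N, rfl⟩, rfl⟩; exact ⟨N, rfl⟩)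
    filter_upwards [Filter.eventually_ge_atTop M] with N hN
    refine (testSeminorm_smul_expo_le _ _ _).trans ?_
    have := pow_pos (weight_pos (m N)) N
    rw [Complex.norm_real, Real.norm_of_nonneg (inv_nonneg.2 this.le), ← div_eq_mul_inv,
      div_le_one this]
    exact pow_le_pow_right₀ (one_le_weight _) hN
  have hU := (map_continuous L).tendsto' 0 0 (map_zero L)
    (Distribution.hasBasis_nhds_zero.mem_of_mem (i := (B, 1)) ⟨hB, one_pos⟩)
  obtain ⟨s, r, hr, hs⟩ := (test_withSeminorms.mem_nhds_iff _ _).1 hU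
  -- This `N` is at least every order in `s`, so `p_N` controls the ball, and at least `2 / r`, the
  -- constant that the ball will yield.
  obtain ⟨N, hN⟩ := exists_nat_ge (max (s.sup id : ℕ) (2 / r) : ℝ)
  have hN1 : s.sup id ≤ N := by exact_mod_cast (le_max_left _ _).trans hN
  have hN2 : 2 / r ≤ N := (le_max_right _ _).trans hN
  have hl := pow_pos (weight_pos (l N)) N
  have hm := pow_pos (weight_pos (m N)) N
  have hmem : ((r / 2 * (weight (l N) ^ N)⁻¹ : ℝ) : ℂ) • expo (l N) ∈
      (s.sup (testSeminorm ι)).ball 0 r := by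
    rw [Seminorm.mem_ball_zero]
    refine lt_of_le_of_lt ?_ (half_lt_self hr)
    have : s.sup (testSeminorm ι) ≤ testSeminorm ι N :=
      Finset.sup_le fun i hi => testSeminorm_mono ((Finset.le_sup (f := id) hi).trans hN1)
    refine (this _).trans ((testSeminorm_smul_expo_le _ _ _).trans (le_of_eq ?_))
    rw [Complex.norm_real, Real.norm_of_nonneg (by positivity)]
    field_simp
  have h1 := hs hmem _ (mem_range_self N)
  rw [map_smul, map_smul, smul_apply, norm_smul, norm_smul, Complex.norm_real,
    Complex.norm_real, Real.norm_of_nonneg (by positivity), Real.norm_of_nonneg (by positivity)]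
    at h1
  have h2 := hlm N
  have h3 : ‖L (expo (l N)) (expo (m N))‖ ≤ 2 / r * (weight (l N) ^ N * weight (m N) ^ N) := by
    field_simp at h1 ⊢
    linarith
  have h4 := mul_le_mul_of_nonneg_right hN2 (mul_pos hl hm).le
  linarith

lemma weight_comp_inl_le (k : ι ⊕ κ → ℤ) : weight (k ∘ Sum.inl) ≤ weight k := by
  simp only [weight, Fintype.sum_sum_type, Function.comp_apply]
  have : 0 ≤ ∑ i : κ, (k (Sum.inr i) : ℝ) ^ 2 := by positivity
  linarith

lemma weight_comp_inr_le (k : ι ⊕ κ → ℤ) : weight (k ∘ Sum.inr) ≤ weight k := by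
  simp only [weight, Fintype.sum_sum_type, Function.comp_apply]
  have : 0 ≤ ∑ i : ι, (k (Sum.inl i) : ℝ) ^ 2 := by positivity
  linarith

lemma kernelToOperator_injective :
    Function.Injective (kernelToOperator : Distribution (κ ⊕ ι) →ₗ[ℂ] Operator ι κ) := by
  intro S T h
  refine Distribution.ext_expo fun k => ?_
  rw [← Sum.elim_comp_inl_inr k, ← tensor_expo, ← kernelToOperator_apply, h, kernelToOperator_apply]

/-- The matrix of `L` is prescribed as the values of `S` on exponentials; both component weights are
at most `weight k`, which gives growth of order `N + N`. -/
lemma kernelToOperator_surjective :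
    Function.Surjective (kernelToOperator : Distribution (κ ⊕ ι) →ₗ[ℂ] Operator ι κ) := by
  intro L
  obtain ⟨N, C, h⟩ := L.exists_norm_apply_expo_le
  have hC : 0 ≤ C := nonneg_of_mul_nonneg_left ((norm_nonneg _).trans (h 0 0))
    (mul_pos (pow_pos (weight_pos _) N) (pow_pos (weight_pos _) N))
  obtain ⟨S, hS⟩ := exists_distribution (fun k : κ ⊕ ι → ℤ =>
    L (expo (k ∘ Sum.inr)) (expo (k ∘ Sum.inl))) (N + N) C fun k => (h _ _).trans (by
      rw [pow_add]
      have h0 := weight_pos k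
      have h1 := weight_pos (k ∘ Sum.inl)
      have h2 := weight_pos (k ∘ Sum.inr)
      gcongr
      · exact weight_comp_inr_le k
      · exact weight_comp_inl_le k)
  refine ⟨S, Operator.ext_expo fun l m => ?_⟩
  rw [kernelToOperator_apply, tensor_expo, hS, Sum.elim_comp_inl, Sum.elim_comp_inr]

/-! ### Compact and bounded sets, and continuity in both directions -/

/-- Rapid decrease of `b` makes the scaled exponentials tend to `0` along the cofinite filter, and
such a family together with its limit is compact. -/
lemma isCompact_insert_zero_range_smul_expo (b : (ι → ℤ) → ℝ)
    (hb : ∀ N : ℕ, ∃ C, ∀ k, weight k ^ N * |b k| ≤ C) :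
    IsCompact (insert (0 : Test ι) (range fun k => (b k : ℂ) • expo k)) := by
  refine Filter.Tendsto.isCompact_insert_range_of_cofinite
    ((test_withSeminorms.tendsto_nhds _ _).2 fun N ε hε => ?_)
  obtain ⟨C, hC⟩ := hb (N + Fintype.card ι)
  have h0 := ((summable_inv_weight_pow_card (ι := ι)).mul_left C).tendsto_cofinite_zero
  filter_upwards [h0.eventually (gt_mem_nhds hε)] with k hk
  rw [sub_zero]
  refine (testSeminorm_smul_expo_le _ _ _).trans_lt (lt_of_le_of_lt ?_ hk)
  have := pow_pos (weight_pos k) (Fintype.card ι)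
  rw [← div_eq_mul_inv, le_div_iff₀ this, Complex.norm_real, Real.norm_eq_abs]
  refine le_trans (le_of_eq ?_) (hC k)
  ring

/-- The coefficients of a bounded set of test functions have a rapidly decreasing common bound
along any map of the frequencies that does not increase the weight. -/
lemma exists_rapidly_decreasing_bound {D : Set (Test ι)} (hD : Bornology.IsVonNBounded ℂ D)
    (π : (ι → ℤ) → (κ → ℤ)) (hπ : ∀ k, weight (π k) ≤ weight k) (r : ℕ) :
    ∃ b : (κ → ℤ) → ℝ, (∀ N : ℕ, ∃ C, ∀ m, weight m ^ N * |b m| ≤ C) ∧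
      ∀ u ∈ D, ∀ k, √(weight k ^ r * ‖u.coeff k‖) ≤ b (π k) := by
  let a (m : κ → ℤ) (p : D × {k // π k = m}) : ℝ :=
    √(weight p.2.1 ^ r * ‖p.1.1.coeff p.2.1‖)
  have ha : ∀ N : ℕ, ∃ C, 0 ≤ C ∧ ∀ m p, a m p ≤ C / weight m ^ N := by
    intro N
    -- Moving `weight ^ N` under the square root doubles the exponent; `r` is already there.
    obtain ⟨R, -, hR⟩ := exists_testSeminorm_le_of_isVonNBounded hD (2 * N + r)
    refine ⟨√R, Real.sqrt_nonneg _, ?_⟩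
    rintro m ⟨⟨u, hu⟩, ⟨k, rfl⟩⟩
    rw [le_div_iff₀ (pow_pos (weight_pos _) N)]
    have h0 := (weight_pos (π k)).le
    have h1 := weight_pos k
    calc √(weight k ^ r * ‖u.coeff k‖) * weight (π k) ^ N
        = √(weight k ^ r * ‖u.coeff k‖ * (weight (π k) ^ N) ^ 2) := by
          rw [Real.sqrt_mul (by positivity) (_ ^ 2), Real.sqrt_sq (by positivity)]
      _ ≤ √(weight k ^ r * ‖u.coeff k‖ * (weight k ^ N) ^ 2) := by
          gcongr
          exact hπ k
      _ = √(weight k ^ (2 * N + r) * ‖u.coeff k‖) := by congr 1; ring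
      _ ≤ √R := Real.sqrt_le_sqrt ((le_testSeminorm _ u k).trans (hR u hu))
  refine ⟨fun m => ⨆ p, a m p, fun N => ?_, fun u hu k => ?_⟩
  · obtain ⟨C, hC, h⟩ := ha N
    refine ⟨C, fun m => ?_⟩
    have hm := pow_pos (weight_pos m) N
    -- The index type is empty when `D` is empty or `m` is not in the range of `π`; the supremum is
    -- then `0`.
    rw [abs_of_nonneg (Real.iSup_nonneg fun p => Real.sqrt_nonneg _), mul_comm,
      ← le_div_iff₀ hm]
    exact Real.iSup_le (h m) (by positivity)
  · obtain ⟨C, -, h⟩ := ha 0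
    exact le_ciSup (f := a (π k)) ⟨C / weight (π k) ^ 0, by rintro _ ⟨p, rfl⟩; exact h _ p⟩
      (⟨u, hu⟩, ⟨k, rfl⟩)

/-- A bounded set of test functions on the product is controlled by tensor products of elements of
compact sets in the factors. -/
lemma exists_isCompact_norm_le {D : Set (Test (κ ⊕ ι))} (hD : Bornology.IsVonNBounded ℂ D) :
    ∃ (A : Set (Test κ)) (K : Set (Test ι)) (C : ℝ), IsCompact A ∧ IsCompact K ∧ 0 < C ∧
      ∀ (S : Distribution (κ ⊕ ι)) (δ : ℝ), (∀ ψ ∈ A, ∀ φ ∈ K, ‖S (tensor ψ φ)‖ ≤ δ) →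
        ∀ u ∈ D, ‖S u‖ ≤ C * δ := by
  set r := Fintype.card (κ ⊕ ι)
  -- Each factor receives one square root of `weight k ^ r * ‖u.coeff k‖`, so the product of the two
  -- envelopes bounds the whole quantity, and `weight k ^ r` makes the sum over `k` converge.
  obtain ⟨b, hb, hbD⟩ := exists_rapidly_decreasing_bound hD (· ∘ Sum.inl) weight_comp_inl_le r
  obtain ⟨c, hc, hcD⟩ := exists_rapidly_decreasing_bound hD (· ∘ Sum.inr) weight_comp_inr_le r
  have hsum := summable_inv_weight_pow_card (ι := κ ⊕ ι)
  refine ⟨_, _, ∑' k : κ ⊕ ι → ℤ, (weight k ^ r)⁻¹,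
    isCompact_insert_zero_range_smul_expo b hb, isCompact_insert_zero_range_smul_expo c hc,
    hsum.tsum_pos (fun k => (inv_pos.2 (pow_pos (weight_pos k) r)).le) 0
      (inv_pos.2 (pow_pos (weight_pos 0) r)), fun S δ h u hu => ?_⟩
  rw [← (S.hasSum u).tsum_eq]
  refine tsum_of_norm_bounded (hsum.hasSum.mul_right δ) fun k => ?_
  have hw := pow_pos (weight_pos k) r
  have h1 := h _ (mem_insert_of_mem _ (mem_range_self (k ∘ Sum.inl)))
    _ (mem_insert_of_mem _ (mem_range_self (k ∘ Sum.inr)))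
  rw [tensor_smul_left, tensor_smul_right, tensor_expo, Sum.elim_comp_inl_inr, map_smul, map_smul,
    norm_smul, norm_smul, Complex.norm_real, Complex.norm_real, ← mul_assoc] at h1
  have h2 : weight k ^ r * ‖u.coeff k‖ ≤ ‖b (k ∘ Sum.inl)‖ * ‖c (k ∘ Sum.inr)‖ := by
    rw [← Real.mul_self_sqrt (mul_nonneg hw.le (norm_nonneg (u.coeff k)))]
    exact mul_le_mul ((hbD u hu k).trans (Real.le_norm_self _))
      ((hcD u hu k).trans (Real.le_norm_self _)) (Real.sqrt_nonneg _) (norm_nonneg _)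
  rw [inv_mul_eq_div, le_div_iff₀ hw, norm_mul]
  refine le_trans (le_of_eq (by ring)) ((mul_le_mul_of_nonneg_right h2 (norm_nonneg _)).trans h1)

lemma continuous_kernelToOperator :
    Continuous (kernelToOperator : Distribution (κ ⊕ ι) →ₗ[ℂ] Operator ι κ) := by
  refine continuous_of_tendsto_nhds_zero _
    ((CompactConvergenceCLM.hasBasis_nhds_zero_of_basis
      Distribution.hasBasis_nhds_zero).tendsto_right_iff.2 ?_)
  rintro ⟨K, B, ε⟩ ⟨hK, hB, hε⟩
  have hD : Bornology.IsVonNBounded ℂ (image2 tensor B K) := by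
    refine test_withSeminorms.isVonNBounded_iff_seminorm_bddAbove.2 fun N => ?_
    obtain ⟨R, hR, hBR⟩ := exists_testSeminorm_le_of_isVonNBounded hB N
    obtain ⟨Q, -, hKQ⟩ := exists_testSeminorm_le_of_isVonNBounded (hK.isVonNBounded ℂ) N
    refine ⟨R * Q, ?_⟩
    rintro _ ⟨_, ⟨ψ, hψ, φ, hφ, rfl⟩, rfl⟩
    exact (testSeminorm_tensor_le N ψ φ).trans
      (mul_le_mul (hBR ψ hψ) (hKQ φ hφ) (apply_nonneg _ _) hR.le)
  filter_upwards [Distribution.hasBasis_nhds_zero.mem_of_mem (i := (_, ε)) ⟨hD, hε⟩]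
    with S hS φ hφ ψ hψ
  exact hS _ ⟨ψ, hψ, φ, hφ, rfl⟩

/-- The linear homeomorphism between kernels and operators. -/
noncomputable def kernelEquiv : Distribution (κ ⊕ ι) ≃L[ℂ] Operator ι κ where
  toLinearEquiv := LinearEquiv.ofBijective kernelToOperator
    ⟨kernelToOperator_injective, kernelToOperator_surjective⟩
  continuous_toFun := continuous_kernelToOperator
  continuous_invFun := by
    set e := LinearEquiv.ofBijective (kernelToOperator : Distribution (κ ⊕ ι) →ₗ[ℂ] Operator ι κ)
      ⟨kernelToOperator_injective, kernelToOperator_surjective⟩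
    refine continuous_of_tendsto_nhds_zero e.symm
      (Distribution.hasBasis_nhds_zero.tendsto_right_iff.2 ?_)
    rintro ⟨D, ε⟩ ⟨hD, hε⟩
    obtain ⟨A, K, C, hA, hK, hC, h⟩ := exists_isCompact_norm_le hD
    -- The two sets play different roles: `K` is used as a compact set in the compact-open topology,
    -- `A` only as a bounded set in the strong dual.
    filter_upwards [(CompactConvergenceCLM.hasBasis_nhds_zero_of_basis
      Distribution.hasBasis_nhds_zero).mem_of_mem (i := (K, A, ε / C))
      ⟨hK, hA.isVonNBounded ℂ, div_pos hε hC⟩] with L hL u hu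
    refine (h (e.symm L) (ε / C) (fun ψ hψ φ hφ => ?_) u hu).trans_eq (mul_div_cancel₀ ε hC.ne')
    have := hL φ hφ ψ hψ
    rwa [← e.apply_symm_apply L] at this

lemma kernelEquiv_eq_iff (S : Distribution (κ ⊕ ι)) (L : Operator ι κ) :
    kernelEquiv S = L ↔ Represents S L := by
  refine ⟨?_, fun h => UniformConvergenceCLM.ext _ _ fun φ => ContinuousLinearMap.ext fun ψ =>
    (h φ ψ).symm⟩
  rintro rfl φ ψ
  rfl

end TorusKernel

theorem theoremA2 (d : ℕ) :
    (∀ L : TorusKernel.Operator (Fin d) (Fin d),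
      ∃! S : TorusKernel.Distribution (Fin d ⊕ Fin d), TorusKernel.Represents S L) ∧
    ∃ t : TorusKernel.Distribution (Fin d ⊕ Fin d) ≃L[ℂ] TorusKernel.Operator (Fin d) (Fin d),
      ∀ (S : TorusKernel.Distribution (Fin d ⊕ Fin d)) (L : TorusKernel.Operator (Fin d) (Fin d)),
        t S = L ↔ TorusKernel.Represents S L := by
  refine ⟨fun L => ?_, TorusKernel.kernelEquiv, TorusKernel.kernelEquiv_eq_iff⟩
  simp only [← TorusKernel.kernelEquiv_eq_iff]
  exact TorusKernel.kernelEquiv.bijective.existsUnique L
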